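/- Let $N,K\ge 1$ be integers. Consider $N$ files $W_1,\dots,W_N$, independent and uniform on $[2^F]$, and $K$ users. For $M\ge 0$ and $\mathbf R=(R_{\mathbf d})_{\mathbf d\in[N]^K}$ with all $R_{\mathbf d}\ge 0$, an $(M,\mathbf R)$ caching scheme of file size $F$ consists of a cache encoder $w\mapsto (z_1(w),\dots,z_K(w))$ with $z_k(w)\in[2^{\lfloor FM\rfloor}]$, an update encoder $(w,\mathbf d)\mapsto x_{\mathbf d}(w)\in[2^{\lfloor FR_{\mathbf d}\rfloor}]$ for $w\in[2^F]^N$ and $\mathbf d\in[N]^K$, and $K$ decoders, the $k$-th of which maps $(z_k,x_{\mathbf d},\mathbf d)$ to an estimate $\hat w_{d_k}\in[2^F]$. Its probability of error is $\max_{\mathbf d}\max_{k}\mathbb P(\hat W_{d_k}\ne W_{d_k})$. The tuple $(M,\mathbf R)$ is achievable if for every $\epsilon>0$ there are $(M,\mathbf R)$ caching schemes, with arbitrarily large file size $F$, whose probability of error is less than $\epsilon$; let $\mathcal R^\star$ be the closure of the set of achievable tuples. Define the optimal average rate under independent uniform requests by $$R^\star_{\sf uniform}(M)=\min_{\mathbf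 R:\,(M,\mathbf R)\in\mathcal R^\star}\ \sum_{\mathbf d\in[N]^K}N^{-K}R_{\mathbf d}.$$ Let $$R_{\sf MN}(K,N,M)=(N-M)\min\Big\{\tfrac1M\Big(1-\big(1-\tfrac MN\big)^K\Big),\,1\Big\}\quad (0<M\le N),\qquad R_{\sf MN}(K,N,0)=\min\{K,N\},$$ and let $\breve R_{\sf MN}(K,N,\cdot)$ be the lower convex envelope of $R_{\sf MN}(K,N,\cdot)$ on $[0,N]$. Then for all $N\ge1$, $K\ge1$ and $M\in[0,N)$, the minimum defining $R^\star_{\sf uniform}(M)$ is attained, $R^\star_{\sf uniform}(M)>0$, and $$\frac{\breve R_{\sf MN}(K,N,M)}{R^\star_{\sf uniform}(M)}<4.7 .$$ -/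

import Mathlib

namespace CodedCaching

noncomputable section

/-- A library of `N` files of `F` bits each: one value in a set of size `2 ^ F` per file. -/
abbrev Library (N F : ℕ) : Type := Fin N → Fin (2 ^ F)

/-- A request vector: user `k` requests the file `d k`. -/
abbrev Requests (N K : ℕ) : Type := Fin K → Fin N

/-- An `(M, R)` caching scheme for `N` files of `F` bits and `K` users. -/
structure Scheme (N K F : ℕ) (M : ℝ) (R : Requests N K → ℝ) where
  /-- cache encoder: the content of the cache of user `k` -/
  cache : Fin K → Library N F → Fin (2 ^ ⌊(F : ℝ) * M⌋₊)
  /-- update encoder: the message broadcast for the request vector `d` -/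
  update : (d : Requests N K) → Library N F → Fin (2 ^ ⌊(F : ℝ) * R d⌋₊)
  /-- decoder of user `k`, who sees the own cache, all requests and the broadcast message -/
  decode : Fin K → Fin (2 ^ ⌊(F : ℝ) * M⌋₊) →
    (d : Requests N K) → Fin (2 ^ ⌊(F : ℝ) * R d⌋₊) → Fin (2 ^ F)

namespace Scheme

variable {N K F : ℕ} {M : ℝ} {R : Requests N K → ℝ}

/-- The estimate by user `k` of the requested file `w (d k)`. -/
def estimate (S : Scheme N K F M R) (d : Requests N K) (k : Fin K) (w : Library N F) :
    Fin (2 ^ F) :=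
  S.decode k (S.cache k w) d (S.update d w)

/-- The probability that user `k` decodes wrongly under the request vector `d`, where the files
are independent and uniform, that is, the library is uniform on `Library N F`. -/
def userError (S : Scheme N K F M R) (d : Requests N K) (k : Fin K) : ℝ :=
  ((Finset.univ.filter fun w : Library N F => S.estimate d k w ≠ w (d k)).card : ℝ) /
    (Fintype.card (Library N F) : ℝ)

/-- The probability of error: the maximum over all request vectors and all users. -/
def errorProb (S : Scheme N K F M R) : ℝ :=
  ⨆ d : Requests N K, ⨆ k : Fin K, S.userError d k

end Scheme

/-- Achievability of a (nonnegative) rate tuple `(M, R)`: for every `ε > 0` there are `(M, R)`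
caching schemes, with arbitrarily large file size, whose probability of error is below `ε`. -/
def Achievable {N K : ℕ} (q : ℝ × (Requests N K → ℝ)) : Prop :=
  0 ≤ q.1 ∧ (∀ d, 0 ≤ q.2 d) ∧
    ∀ ε : ℝ, 0 < ε → ∀ F₀ : ℕ, ∃ F : ℕ, F₀ ≤ F ∧ 0 < F ∧
      ∃ S : Scheme N K F q.1 q.2, S.errorProb < ε

/-- The optimal rate region: the closure of the set of achievable rate tuples. -/
def optimalRegion (N K : ℕ) : Set (ℝ × (Requests N K → ℝ)) :=
  closure {q | Achievable q}

/-- The average rates `∑ d, p d * R d` of all `R` with `(M, R)` in the optimal rate region. -/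
def avgRates {N K : ℕ} (p : Requests N K → ℝ) (M : ℝ) : Set ℝ :=
  (fun R : Requests N K → ℝ => ∑ d, p d * R d) '' {R | (M, R) ∈ optimalRegion N K}

/-- The optimal average rate with memory `M` when the request vector has probability mass
function `p`. -/
def optimalAvgRate {N K : ℕ} (p : Requests N K → ℝ) (M : ℝ) : ℝ :=
  sInf (avgRates p M)

/-- The law of `K` independent requests, each with probability mass function `pD`. -/
def iidRequests {N : ℕ} (K : ℕ) (pD : Fin N → ℝ) : Requests N K → ℝ :=
  fun d => ∏ k, pD (d k)

/-- The law of `K` independent requests, each uniform on the `N` files. -/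
def uniformRequests (N K : ℕ) : Requests N K → ℝ :=
  iidRequests K fun _ : Fin N => 1 / (N : ℝ)

/-- The optimal average rate for independent uniform requests. -/
def optimalUniformRate (N K : ℕ) (M : ℝ) : ℝ :=
  optimalAvgRate (uniformRequests N K) M

/-- The rate of the decentralized coded caching scheme, for `0 ≤ M ≤ N`. -/
def rateMN (K N : ℕ) (M : ℝ) : ℝ :=
  if M = 0 then min (K : ℝ) (N : ℝ)
  else ((N : ℝ) - M) * min (1 / M * (1 - (1 - M / (N : ℝ)) ^ K)) 1

/-- The convexified (time-shared) rate: the smallest rate at memory `M` among all convex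
combinations of the points `(m, rateMN K N m)` with `0 ≤ m ≤ N`, i.e. the lower convex envelope
of `rateMN K N` on `[0, N]`. -/
def convexifiedRateMN (K N : ℕ) (M : ℝ) : ℝ :=
  sInf {r : ℝ | (M, r) ∈
    convexHull ℝ ((fun m : ℝ => (m, rateMN K N m)) '' Set.Icc (0 : ℝ) (N : ℝ))}

end

end CodedCaching

/-!
Converse for coded caching with uniform requests, and a comparison with the decentralized scheme
that yields the gap `4`.

**Converse.** Let `X` be the message for the request vector `d`, let `Z k` be the caches and `W n`
the files. As `X` and `Z k` determine `W (d k)`, serving the users one after the other gives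
`H(X) ≥ ∑ k < ℓ, H(W (d k) | Z 0, …, Z k, W (d 0), …, W (d (k - 1)))`. The request `d k` is uniform
and independent of the earlier ones, so the mean of the `k`-th summand over `d k` is at least
`1 / N` times the conditional entropy of the whole library, which is at least
`N F - k F - (k + 1) M F` bits. Hence the average rate is at least
`converseRate N ℓ M = ℓ - (ℓ (ℓ - 1) / 2 + ℓ (ℓ + 1) / 2 * M) / N` for every `ℓ ≤ K`
(`le_sum_entropy_message`). Decoding errors are handled by adding to the message the correction
that each user needs, which costs little by Fano's inequality (`Scheme.entropy_correction_le`), and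
the bound passes to the closure of the achievable tuples because it is a closed condition.

**Comparison.** The convexified rate is at most `rateMN K N M`, which by Bernoulli's inequality is
at most `(N - M) * min (K / N) (min 1 (1 / M))`. The converse is a concave quadratic in `ℓ`. If it
increases up to `K`, take `ℓ = K`; otherwise take the integer nearest to its vertex. In both cases
it is at least a quarter of the bound on `rateMN K N M` (`exists_le_four_mul_converseRate`).

Random variables on the library are represented by the partitions that they induce: joint
variables are infima, and "determines" is `≤`. Submodularity of entropy is then a statement about
block sizes (`sum_card_block_ratio_le`).
-/

namespace CodedCaching

open Finset Real

/-! ### Entropy of partitions of a finite uniform probability space -/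

section Entropy

variable {Ω : Type*} [Fintype Ω]

open Classical in
/-- The block of the partition `r` that contains `ω`. -/
noncomputable def block (r : Setoid Ω) (ω : Ω) : Finset Ω := {ω' | r ω' ω}

/-- The Shannon entropy, in nats, of the partition `r` of the uniform probability space `Ω`: the
mean of `log (1 / P(block of ω))`. A random variable `X` on `Ω` enters through the partition
`Setoid.ker X`; the joint variable `(X, Y)` is then `ker X ⊓ ker Y`, and `ker X ≤ ker Y` says that
`X` determines `Y`. -/
noncomputable def entropy (r : Setoid Ω) : ℝ :=
  (∑ ω, log ((Fintype.card Ω : ℝ) / (block r ω).card)) / Fintype.card Ω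

@[simp]
lemma mem_block {r : Setoid Ω} {ω ω' : Ω} : ω' ∈ block r ω ↔ r ω' ω := by
  simp [block]

lemma card_block_pos (r : Setoid Ω) (ω : Ω) : (0 : ℝ) < (block r ω).card :=
  Nat.cast_pos.2 (card_pos.2 ⟨ω, mem_block.2 (r.refl' ω)⟩)

lemma block_eq_of_rel {r : Setoid Ω} {ω ω' : Ω} (h : r ω ω') : block r ω = block r ω' := by
  ext v
  simp only [mem_block]
  exact ⟨fun hv => r.trans' hv h, fun hv => r.trans' hv (r.symm' h)⟩

lemma card_univ_pos (ω : Ω) : (0 : ℝ) < Fintype.card Ω :=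
  Nat.cast_pos.2 (Fintype.card_pos_iff.2 ⟨ω⟩)

lemma entropy_mono {r s : Setoid Ω} (h : r ≤ s) : entropy s ≤ entropy r := by
  unfold entropy
  refine div_le_div_of_nonneg_right (sum_le_sum fun ω _ => ?_) (Nat.cast_nonneg _)
  have hs := card_block_pos s ω
  have hr := card_block_pos r ω
  have hΩ := card_univ_pos ω
  refine log_le_log (div_pos hΩ hs) (div_le_div_of_nonneg_left hΩ.le hr ?_)
  exact Nat.cast_le.2 (card_le_card fun v hv => mem_block.2 (h (mem_block.1 hv)))

lemma entropy_top : entropy (⊤ : Setoid Ω) = 0 := by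
  unfold entropy
  rw [sum_eq_zero, zero_div]
  intro ω _
  have : block (⊤ : Setoid Ω) ω = univ := by ext; simp
  rw [this, card_univ, div_self (card_univ_pos ω).ne', log_one]

lemma entropy_bot [Nonempty Ω] : entropy (⊥ : Setoid Ω) = log (Fintype.card Ω) := by
  have hb (ω : Ω) : block (⊥ : Setoid Ω) ω = {ω} := by
    ext v
    simp
  have h0 : (Fintype.card Ω : ℝ) ≠ 0 := Nat.cast_ne_zero.2 Fintype.card_ne_zero
  simp [entropy, hb, h0]

/-- The counting inequality behind submodularity. The numerator counts the pairs `(u, v)` of points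
that agree with `ω` modulo `a ⊓ c` and `b ⊓ c` respectively; for a fixed pair the possible `ω` form
at most one block of `a ⊓ b ⊓ c`. -/
lemma sum_card_block_ratio_le (a b c : Setoid Ω) :
    ∑ ω, ((block (a ⊓ c) ω).card * (block (b ⊓ c) ω).card : ℝ) /
      ((block (a ⊓ b ⊓ c) ω).card * (block c ω).card) ≤ Fintype.card Ω := by
  classical
  let g (ω u v : Ω) : ℝ :=
    if (a ⊓ c) u ω ∧ (b ⊓ c) v ω then
      1 / ((block (a ⊓ b ⊓ c) ω).card * (block c ω).card : ℝ) else 0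
  have h1 (ω : Ω) : ((block (a ⊓ c) ω).card * (block (b ⊓ c) ω).card : ℝ) /
      ((block (a ⊓ b ⊓ c) ω).card * (block c ω).card) = ∑ u, ∑ v, g ω u v := by
    have : ∑ u, ∑ v, g ω u v = ∑ u ∈ block (a ⊓ c) ω, ∑ v ∈ block (b ⊓ c) ω,
        1 / ((block (a ⊓ b ⊓ c) ω).card * (block c ω).card : ℝ) := by
      simp only [block, sum_filter, g, ite_and]
      refine sum_congr rfl fun u _ => ?_
      split_ifs <;> simp
    rw [this]
    simp only [sum_const, nsmul_eq_mul]
    ring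
  have h2 (u v : Ω) : ∑ ω, g ω u v ≤ if c v u then 1 / ((block c u).card : ℝ) else 0 := by
    by_cases hne : ∃ ω₀, (a ⊓ c) u ω₀ ∧ (b ⊓ c) v ω₀
    · obtain ⟨ω₀, hu, hv⟩ := hne
      have hc : c v u := c.trans' hv.2 (c.symm' hu.2)
      rw [if_pos hc]
      have hg (ω : Ω) : g ω u v ≤ if ω ∈ block (a ⊓ b ⊓ c) ω₀ then
          1 / ((block (a ⊓ b ⊓ c) ω₀).card * (block c u).card : ℝ) else 0 := by
        by_cases hω : (a ⊓ c) u ω ∧ (b ⊓ c) v ω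
        · have hr : (a ⊓ b ⊓ c) ω ω₀ :=
            ⟨⟨a.trans' (a.symm' hω.1.1) hu.1, b.trans' (b.symm' hω.2.1) hv.1⟩,
              c.trans' (c.symm' hω.1.2) hu.2⟩
          simp only [g]
          rw [if_pos hω, if_pos (mem_block.2 hr), block_eq_of_rel hr,
            block_eq_of_rel (c.symm' hω.1.2)]
        · simp only [g]
          rw [if_neg hω]
          split_ifs <;> positivity
      refine (sum_le_sum fun ω _ => hg ω).trans (le_of_eq ?_)
      rw [sum_ite_mem, univ_inter, sum_const, nsmul_eq_mul]
      have := (card_block_pos (a ⊓ b ⊓ c) ω₀).ne'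
      have := (card_block_pos c u).ne'
      field_simp
    · rw [sum_eq_zero]
      · split_ifs <;> positivity
      · intro ω _
        exact if_neg fun h => hne ⟨ω, h⟩
  calc _ = ∑ ω, ∑ u, ∑ v, g ω u v := sum_congr rfl fun ω _ => h1 ω
    _ = ∑ u, ∑ v, ∑ ω, g ω u v := by
        rw [sum_comm]
        exact sum_congr rfl fun u _ => sum_comm
    _ ≤ ∑ u, ∑ v, if c v u then 1 / ((block c u).card : ℝ) else 0 :=
        sum_le_sum fun u _ => sum_le_sum fun v _ => h2 u v
    _ = ∑ u : Ω, (1 : ℝ) := by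
        refine sum_congr rfl fun u _ => ?_
        rw [← sum_filter]
        change ∑ v ∈ block c u, _ = _
        rw [sum_const, nsmul_eq_mul, mul_one_div_cancel (card_block_pos c u).ne']
    _ = Fintype.card Ω := by simp

/-- Submodularity of entropy, that is, `H(a, b | c) ≤ H(a | c) + H(b | c)`. -/
lemma entropy_submodular (a b c : Setoid Ω) :
    entropy (a ⊓ b ⊓ c) + entropy c ≤ entropy (a ⊓ c) + entropy (b ⊓ c) := by
  unfold entropy
  rw [← add_div, ← add_div, ← sum_add_distrib, ← sum_add_distrib]
  refine div_le_div_of_nonneg_right ?_ (Nat.cast_nonneg _)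
  rw [← sub_nonneg, ← sum_sub_distrib]
  have key := sum_card_block_ratio_le a b c
  have : ∑ ω : Ω, (1 - ((block (a ⊓ c) ω).card * (block (b ⊓ c) ω).card : ℝ) /
      ((block (a ⊓ b ⊓ c) ω).card * (block c ω).card)) ≥ 0 := by
    rw [sum_sub_distrib]
    simpa using key
  refine le_trans this (sum_le_sum fun ω _ => ?_)
  have hΩ := card_univ_pos ω
  have h1 := card_block_pos (a ⊓ c) ω
  have h2 := card_block_pos (b ⊓ c) ω
  have h3 := card_block_pos (a ⊓ b ⊓ c) ω
  have h4 := card_block_pos c ω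
  have hl := log_le_sub_one_of_pos (div_pos (mul_pos h1 h2) (mul_pos h3 h4))
  rw [log_div (mul_pos h1 h2).ne' (mul_pos h3 h4).ne', log_mul h1.ne' h2.ne',
    log_mul h3.ne' h4.ne'] at hl
  rw [log_div hΩ.ne' h1.ne', log_div hΩ.ne' h2.ne', log_div hΩ.ne' h3.ne', log_div hΩ.ne' h4.ne']
  linarith

lemma entropy_inf_le (a b : Setoid Ω) : entropy (a ⊓ b) ≤ entropy a + entropy b := by
  simpa [entropy_top] using entropy_submodular a b ⊤

lemma entropy_finset_inf_le {ι : Type*} (s : Finset ι) (f : ι → Setoid Ω) :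
    entropy (s.inf f) ≤ ∑ i ∈ s, entropy (f i) := by
  classical
  induction s using Finset.induction_on with
  | empty => simp [entropy_top]
  | insert i s hi ih =>
    rw [inf_insert, sum_insert hi]
    exact (entropy_inf_le _ _).trans (by gcongr)

/-- Conditional subadditivity, `H(f i, i ∈ s | b) ≤ ∑ i ∈ s, H(f i | b)`. -/
lemma entropy_finset_inf_inf_sub_le {ι : Type*} (s : Finset ι) (f : ι → Setoid Ω)
    (b : Setoid Ω) :
    entropy (s.inf f ⊓ b) - entropy b ≤ ∑ i ∈ s, (entropy (f i ⊓ b) - entropy b) := by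
  classical
  induction s using Finset.induction_on with
  | empty => simp
  | insert i s hi ih =>
    rw [inf_insert, sum_insert hi]
    have := entropy_submodular (f i) (s.inf f) b
    linarith

/-- Gibbs' inequality for the variable `X`, with a weight `q` that need not be normalized. -/
lemma entropy_ker_le [Nonempty Ω] {α : Type*} [Fintype α] (X : Ω → α) (q : α → ℝ)
    (hq : ∀ x, 0 < q x) :
    entropy (Setoid.ker X) ≤ (∑ ω, -log (q (X ω))) / Fintype.card Ω + (∑ x, q x) - 1 := by
  classical
  have hΩ : (0 : ℝ) < Fintype.card Ω := card_univ_pos (Classical.arbitrary Ω)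
  have hb (ω : Ω) : block (Setoid.ker X) ω = ({ω' | X ω' = X ω} : Finset Ω) := by
    ext v
    simp [Setoid.ker_def]
  have hsum : ∑ ω, q (X ω) / (block (Setoid.ker X) ω).card ≤ ∑ x, q x := by
    rw [← sum_fiberwise univ X]
    refine sum_le_sum fun x _ => ?_
    rw [sum_congr rfl (g := fun _ => q x / (({ω' | X ω' = x} : Finset Ω).card : ℝ))
      (fun ω hω => by rw [hb, (mem_filter.1 hω).2]), sum_const, nsmul_eq_mul]
    rw [mul_div_left_comm]
    exact mul_le_of_le_one_right (hq x).le (div_self_le_one _)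
  have hterm (ω : Ω) : log ((Fintype.card Ω : ℝ) / (block (Setoid.ker X) ω).card) ≤
      -log (q (X ω)) + Fintype.card Ω * (q (X ω) / (block (Setoid.ker X) ω).card) - 1 := by
    have h1 := card_block_pos (Setoid.ker X) ω
    have h2 := log_le_sub_one_of_pos (mul_pos (div_pos hΩ h1) (hq (X ω)))
    rw [log_mul (div_pos hΩ h1).ne' (hq _).ne'] at h2
    have : (Fintype.card Ω : ℝ) / (block (Setoid.ker X) ω).card * q (X ω) =
      Fintype.card Ω * (q (X ω) / (block (Setoid.ker X) ω).card) := by ring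
    linarith
  unfold entropy
  rw [div_le_iff₀ hΩ]
  refine (sum_le_sum fun ω _ => hterm ω).trans ?_
  rw [sum_sub_distrib, sum_add_distrib, ← mul_sum]
  have := mul_le_mul_of_nonneg_left hsum hΩ.le
  simp only [sum_const, card_univ, nsmul_eq_mul, mul_one]
  rw [sub_mul, add_mul, div_mul_cancel₀ _ hΩ.ne']
  linarith

lemma entropy_ker_le_log_card [Nonempty Ω] {α : Type*} [Fintype α] (X : Ω → α) :
    entropy (Setoid.ker X) ≤ log (Fintype.card α) := by
  have hα : (0 : ℝ) < Fintype.card α := card_univ_pos (X (Classical.arbitrary Ω))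
  have hΩ : (Fintype.card Ω : ℝ) ≠ 0 := (card_univ_pos (Classical.arbitrary Ω)).ne'
  have := entropy_ker_le X (fun _ => (Fintype.card α : ℝ)⁻¹) (fun _ => inv_pos.2 hα)
  simpa [hα.ne', hΩ] using this

end Entropy

/-! ### The entropic converse -/

/-- One link of the converse chain: if `x` and the cache `z` determine the file `v`, then
`H(x | h) ≥ H(v | z, h) + H(x | z, v, h)`. -/
lemma entropy_chain_step {Ω : Type*} [Fintype Ω] {x z v : Setoid Ω} (h : Setoid Ω)
    (hv : x ⊓ z ≤ v) :
    (entropy (v ⊓ (z ⊓ h)) - entropy (z ⊓ h)) +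
      (entropy (x ⊓ (z ⊓ v ⊓ h)) - entropy (z ⊓ v ⊓ h)) ≤ entropy (x ⊓ h) - entropy h := by
  have h1 : x ⊓ (z ⊓ v ⊓ h) = x ⊓ z ⊓ h := by
    refine le_antisymm (le_inf (le_inf inf_le_left ?_) ?_)
      (le_inf ?_ (le_inf (le_inf ?_ (inf_le_left.trans hv)) inf_le_right))
    · exact inf_le_right.trans (inf_le_left.trans inf_le_left)
    · exact inf_le_right.trans inf_le_right
    · exact inf_le_left.trans inf_le_left
    · exact inf_le_left.trans inf_le_right
  have h2 : v ⊓ (z ⊓ h) = z ⊓ v ⊓ h := by ac_rfl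
  have := entropy_submodular x z h
  rw [h1, h2]
  linarith

/-- Resampling the coordinate `a` of a uniform `d : ι → α`, for `G d` that ignores `d a`. -/
lemma card_mul_sum_apply_eq {ι α : Type*} [Fintype ι] [DecidableEq ι] [Fintype α] (a : ι)
    (G : (ι → α) → α → ℝ) (hG : ∀ d m, G (Function.update d a m) = G d) :
    (Fintype.card α : ℝ) * ∑ d, G d (d a) = ∑ d, ∑ n, G d n := by
  have hinv : Function.Involutive
      (fun p : (ι → α) × α => (Function.update p.1 a p.2, p.1 a)) := by
    rintro ⟨d, n⟩
    simp
  rw [← Fintype.sum_prod_type' (f := G),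
    ← Function.Bijective.sum_comp hinv.bijective (fun p : (ι → α) × α => G p.1 p.2)]
  simp only [hG]
  rw [Fintype.sum_prod_type, mul_sum]
  simp

/-- The converse in terms of entropies, for messages `x d` that together with the cache `z k`
determine the file `w (d k)`, averaged over all `d`. The users in `s` are served one after the
other. Once `j` of them have been served, their caches and files together with the next cache
carry at most `j * L + (j + 1) * C` of the `N * L` of the library, and by conditional
subadditivity a uniformly chosen next file gets the `N`-th part of what is missing. -/
lemma le_sum_entropy_message {Ω ι α : Type*} [Fintype Ω] [Fintype ι] [DecidableEq ι]
    [Fintype α] [Nonempty α] {w : α → Setoid Ω} {z : ι → Setoid Ω} {x : (ι → α) → Setoid Ω} {L C : ℝ}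
    (hx : ∀ d k, x d ⊓ z k ≤ w (d k)) (hw : univ.inf w = ⊥)
    (hwL : ∀ n, entropy (w n) ≤ L) (hzC : ∀ k, entropy (z k) ≤ C)
    (hL : Fintype.card α * L ≤ entropy (⊥ : Setoid Ω)) (s : Finset ι) :
    (Fintype.card (ι → α) : ℝ) * (#s * L - (#s * (#s - 1) / 2 * L + #s * (#s + 1) / 2 * C) /
      Fintype.card α) ≤ ∑ d, entropy (x d) := by
  have hα : (0 : ℝ) < Fintype.card α := Nat.cast_pos.2 Fintype.card_pos
  let hist (d : ι → α) (s : Finset ι) : Setoid Ω := s.inf fun k => z k ⊓ w (d k)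
  suffices H : (Fintype.card (ι → α) : ℝ) *
      (#s * L - (#s * (#s - 1) / 2 * L + #s * (#s + 1) / 2 * C) / Fintype.card α) ≤
      ∑ d, (entropy (x d) - (entropy (x d ⊓ hist d s) - entropy (hist d s))) by
    refine H.trans (sum_le_sum fun d _ => ?_)
    have := entropy_mono (inf_le_right : x d ⊓ hist d s ≤ hist d s)
    linarith
  induction s using Finset.induction_on with
  | empty => simp [hist, entropy_top]
  | insert a s ha ih =>
    let G (d : ι → α) (n : α) : ℝ :=
      entropy (w n ⊓ (z a ⊓ hist d s)) - entropy (z a ⊓ hist d s)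
    have hG (d : ι → α) (m : α) : G (Function.update d a m) = G d := by
      have : hist (Function.update d a m) s = hist d s := by
        refine Finset.inf_congr rfl fun k hk => ?_
        rw [Function.update_of_ne (ne_of_mem_of_not_mem hk ha)]
      simp only [G, this]
    have hsumG (d : ι → α) : Fintype.card α * L - (C + #s * (C + L)) ≤ ∑ n, G d n := by
      have h1 := entropy_finset_inf_inf_sub_le univ w (z a ⊓ hist d s)
      rw [hw, bot_inf_eq] at h1
      have h2 : entropy (hist d s) ≤ #s * (C + L) := by
        refine (entropy_finset_inf_le s _).trans ?_
        rw [← nsmul_eq_mul]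
        exact sum_le_card_nsmul _ _ _ fun k _ =>
          (entropy_inf_le _ _).trans (add_le_add (hzC k) (hwL _))
      have h3 := entropy_inf_le (z a) (hist d s)
      have h4 := hzC a
      simp only [G]
      linarith
    have hstep : ∑ d, G d (d a) +
        ∑ d, (entropy (x d) - (entropy (x d ⊓ hist d s) - entropy (hist d s))) ≤
        ∑ d, (entropy (x d) - (entropy (x d ⊓ hist d (insert a s)) -
          entropy (hist d (insert a s)))) := by
      rw [← sum_add_distrib]
      refine sum_le_sum fun d _ => ?_
      have := entropy_chain_step (hist d s) (hx d a)
      have hi : hist d (insert a s) = z a ⊓ w (d a) ⊓ hist d s := inf_insert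
      rw [hi]
      simp only [G]
      linarith
    have havg : (Fintype.card (ι → α) : ℝ) *
        ((Fintype.card α * L - (C + #s * (C + L))) / Fintype.card α) ≤ ∑ d, G d (d a) := by
      rw [← mul_div_assoc, div_le_iff₀ hα, mul_comm _ (Fintype.card α : ℝ),
        card_mul_sum_apply_eq a G hG, ← nsmul_eq_mul]
      exact card_nsmul_le_sum _ _ _ fun d _ => hsumG d
    refine le_trans (le_of_eq ?_) ((add_le_add havg ih).trans hstep)
    rw [card_insert_of_notMem ha]
    push_cast
    field_simp
    ring

/-! ### From schemes to entropies -/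

/-- The lower bound on the average rate that serving `ℓ` of the users yields, as a function of
the cache size `M`. -/
noncomputable def converseRate (N ℓ : ℕ) (M : ℝ) : ℝ :=
  ℓ - (ℓ * (ℓ - 1) / 2 + ℓ * (ℓ + 1) / 2 * M) / N

lemma uniformRequests_apply (N K : ℕ) (d : Requests N K) :
    uniformRequests N K d = ((Fintype.card (Requests N K) : ℝ))⁻¹ := by
  simp [uniformRequests, iidRequests]

namespace Scheme

variable {N K F : ℕ} {M : ℝ} {R : Requests N K → ℝ}

/-- The correction that user `k` needs to decode without error: nothing if the estimate is right,
and the requested file otherwise. -/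
def correction (S : Scheme N K F M R) (d : Requests N K) (k : Fin K) (w : Library N F) :
    Option (Fin (2 ^ F)) :=
  if S.estimate d k w = w (d k) then none else some (w (d k))

/-- The broadcast message together with the corrections for all users. -/
noncomputable def corrected (S : Scheme N K F M R) (d : Requests N K) : Setoid (Library N F) :=
  Setoid.ker (S.update d) ⊓ univ.inf fun k => Setoid.ker (S.correction d k)

lemma corrected_inf_cache_le (S : Scheme N K F M R) (d : Requests N K) (k : Fin K) :
    S.corrected d ⊓ Setoid.ker (S.cache k) ≤ Setoid.ker fun w : Library N F => w (d k) := by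
  rintro u v ⟨⟨hu, hcorr⟩, hc⟩
  have hk : S.correction d k u = S.correction d k v :=
    (inf_le (mem_univ k) : univ.inf (fun k => Setoid.ker (S.correction d k)) ≤ _) hcorr
  have he : S.estimate d k u = S.estimate d k v := by
    change S.decode k (S.cache k u) d (S.update d u) = S.decode k (S.cache k v) d (S.update d v)
    rw [show S.cache k u = S.cache k v from hc, show S.update d u = S.update d v from hu]
  change u (d k) = v (d k)
  unfold correction at hk
  split_ifs at hk with h1 h2 <;> simp_all

/-- Fano's inequality, in the form that a correction carries little information. -/
lemma entropy_correction_le (S : Scheme N K F M R) (d : Requests N K) (k : Fin K) :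
    entropy (Setoid.ker (S.correction d k)) ≤ 1 + S.userError d k * (F * log 2) := by
  have hF : (0 : ℝ) < 2 ^ F := by positivity
  have h := entropy_ker_le (S.correction d k) (fun o => o.elim 1 fun _ => ((2 : ℝ) ^ F)⁻¹)
    (by rintro (_ | _) <;> simp)
  have h1 : ∑ o : Option (Fin (2 ^ F)), (o.elim 1 fun _ => ((2 : ℝ) ^ F)⁻¹) = 2 := by
    rw [Fintype.sum_option]
    simp [hF.ne']
    norm_num
  have h2 (w : Library N F) :
      -log ((S.correction d k w).elim 1 fun _ => ((2 : ℝ) ^ F)⁻¹) =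
        if S.estimate d k w ≠ w (d k) then F * log 2 else 0 := by
    unfold correction
    split_ifs <;> simp_all
  rw [h1, sum_congr rfl fun w _ => h2 w, ← sum_filter, sum_const, nsmul_eq_mul] at h
  refine h.trans (le_of_eq ?_)
  unfold userError
  ring

lemma userError_le_errorProb (S : Scheme N K F M R) (d : Requests N K) (k : Fin K) :
    S.userError d k ≤ S.errorProb :=
  (le_ciSup (f := S.userError d) (Set.finite_range _).bddAbove k).trans
    (le_ciSup (f := fun d => ⨆ k, S.userError d k) (Set.finite_range _).bddAbove d)

lemma log_two_pow_floor_le {x : ℝ} (hx : 0 ≤ x) :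
    log (Fintype.card (Fin (2 ^ ⌊(F : ℝ) * x⌋₊))) ≤ F * x * log 2 := by
  rw [Fintype.card_fin, Nat.cast_pow, log_pow, Nat.cast_ofNat]
  exact mul_le_mul_of_nonneg_right (Nat.floor_le (by positivity)) (log_nonneg one_le_two)

lemma entropy_corrected_le (S : Scheme N K F M R) (d : Requests N K) (hR : 0 ≤ R d) :
    entropy (S.corrected d) ≤ F * R d * log 2 + K * (1 + S.errorProb * (F * log 2)) := by
  refine (entropy_inf_le _ _).trans (add_le_add ?_ ?_)
  · exact (entropy_ker_le_log_card _).trans (log_two_pow_floor_le hR)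
  · refine (entropy_finset_inf_le _ _).trans ?_
    have hl : 0 ≤ log 2 := log_nonneg one_le_two
    have := sum_le_card_nsmul univ (fun k => entropy (Setoid.ker (S.correction d k)))
      (1 + S.errorProb * (F * log 2)) fun k _ => (S.entropy_correction_le d k).trans (by
        have := S.userError_le_errorProb d k
        gcongr)
    rwa [card_univ, Fintype.card_fin, nsmul_eq_mul] at this

/-- The converse for a single scheme. -/
lemma converseRate_le (S : Scheme N K F M R) (hN : 0 < N) (hF : 0 < F) (hM : 0 ≤ M)
    (hR : ∀ d, 0 ≤ R d) {ℓ : ℕ} (hℓ : ℓ ≤ K) :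
    converseRate N ℓ M ≤
      ∑ d, uniformRequests N K d * R d + K * (1 / (F * log 2) + S.errorProb) := by
  have : Nonempty (Fin N) := ⟨⟨0, hN⟩⟩
  obtain ⟨s, -, hs⟩ := exists_subset_card_eq (s := (univ : Finset (Fin K))) (n := ℓ) (by simpa)
  have hl : 0 < log 2 := log_pos one_lt_two
  have hF' : (0 : ℝ) < F := Nat.cast_pos.2 hF
  have hN' : (0 : ℝ) < N := Nat.cast_pos.2 hN
  have hc : (0 : ℝ) < Fintype.card (Requests N K) := Nat.cast_pos.2 Fintype.card_pos
  have key := le_sum_entropy_message (x := S.corrected)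
    (w := fun n => Setoid.ker fun w : Library N F => w n) (z := fun k => Setoid.ker (S.cache k))
    (L := F * log 2) (C := F * M * log 2) S.corrected_inf_cache_le
    (by
      refine le_bot_iff.1 fun u v huv => funext fun n => ?_
      exact (inf_le (mem_univ n) :
        univ.inf (fun n => Setoid.ker fun w : Library N F => w n) ≤ _) huv)
    (fun n => (entropy_ker_le_log_card _).trans (by simp))
    (fun k => (entropy_ker_le_log_card _).trans (log_two_pow_floor_le hM))
    (by simp [entropy_bot]) s
  rw [hs, Fintype.card_fin] at key
  have hle := key.trans (sum_le_sum fun d _ => S.entropy_corrected_le d (hR d))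
  rw [sum_add_distrib, sum_const, card_univ, nsmul_eq_mul, ← sum_mul, ← mul_sum] at hle
  simp only [uniformRequests_apply, ← mul_sum]
  have hne := hl.ne'
  have hk : (Fintype.card (Requests N K) : ℝ) * (F * log 2) * converseRate N ℓ M ≤
      Fintype.card (Requests N K) * (F * log 2) *
        ((Fintype.card (Requests N K) : ℝ)⁻¹ * ∑ d, R d +
          K * (1 / (F * log 2) + S.errorProb)) := by
    refine le_trans (le_of_eq ?_) (hle.trans (le_of_eq ?_))
    · unfold converseRate
      ring
    · field_simp
  exact le_of_mul_le_mul_left hk (by positivity)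

end Scheme

/-! ### The optimal region -/

lemma uniformRequests_pos {N : ℕ} (hN : 0 < N) (K : ℕ) (d : Requests N K) :
    0 < uniformRequests N K d := by
  have : Nonempty (Fin N) := ⟨⟨0, hN⟩⟩
  rw [uniformRequests_apply]
  exact inv_pos.2 (Nat.cast_pos.2 Fintype.card_pos)

lemma Achievable.converseRate_le {N K : ℕ} (hN : 0 < N) {ℓ : ℕ} (hℓ : ℓ ≤ K)
    {q : ℝ × (Requests N K → ℝ)} (hq : Achievable q) :
    converseRate N ℓ q.1 ≤ ∑ d, uniformRequests N K d * q.2 d := by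
  obtain ⟨hM, hR, h⟩ := hq
  refine le_of_forall_pos_le_add fun ε hε => ?_
  have hl : 0 < log 2 := log_pos one_lt_two
  have hK : (0 : ℝ) < 2 * (K + 1) := by positivity
  obtain ⟨F₀, hF₀⟩ := exists_nat_gt (2 * (K + 1) / (ε * log 2))
  obtain ⟨F, hF, hF', S, hS⟩ := h (ε / (2 * (K + 1))) (by positivity) F₀
  refine (S.converseRate_le hN hF' hM hR hℓ).trans (add_le_add le_rfl ?_)
  have hFpos : (0 : ℝ) < F := Nat.cast_pos.2 hF'
  have h1 : 1 / (F * log 2) ≤ ε / (2 * (K + 1)) := by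
    have h2 : 2 * (K + 1) / (ε * log 2) ≤ (F : ℝ) := hF₀.le.trans (Nat.cast_le.2 hF)
    rw [div_le_iff₀ (by positivity)] at h2
    rw [div_le_div_iff₀ (by positivity) hK]
    linarith
  calc (K : ℝ) * (1 / (F * log 2) + S.errorProb)
      ≤ K * (ε / (2 * (K + 1)) + ε / (2 * (K + 1))) := by gcongr
    _ = ε * (K / (K + 1)) := by field_simp; ring
    _ ≤ ε := mul_le_of_le_one_right hε.le ((div_le_one (by positivity)).2 (by linarith))

lemma converseRate_le_of_mem_optimalRegion {N K : ℕ} (hN : 0 < N) {ℓ : ℕ} (hℓ : ℓ ≤ K)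
    {q : ℝ × (Requests N K → ℝ)} (hq : q ∈ optimalRegion N K) :
    converseRate N ℓ q.1 ≤ ∑ d, uniformRequests N K d * q.2 d := by
  refine closure_minimal (t := {q : ℝ × (Requests N K → ℝ) |
    converseRate N ℓ q.1 ≤ ∑ d, uniformRequests N K d * q.2 d})
    (fun q hq => hq.converseRate_le hN hℓ) (isClosed_le ?_ ?_) hq
  · unfold converseRate
    fun_prop
  · fun_prop

lemma nonneg_of_mem_optimalRegion {N K : ℕ} {q : ℝ × (Requests N K → ℝ)}
    (hq : q ∈ optimalRegion N K) (d : Requests N K) : 0 ≤ q.2 d := by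
  refine closure_minimal (t := {q : ℝ × (Requests N K → ℝ) | 0 ≤ q.2 d})
    (fun q hq => hq.2.1 d) (isClosed_le ?_ ?_) hq <;> fun_prop

/-- Broadcasting the whole library achieves rate `N` with any cache size. -/
lemma achievable_const {N K : ℕ} {M : ℝ} (hM : 0 ≤ M) :
    Achievable (N := N) (K := K) (M, fun _ => (N : ℝ)) := by
  refine ⟨hM, fun _ => Nat.cast_nonneg _, fun ε hε F₀ =>
    ⟨F₀ + 1, Nat.le_succ _, Nat.succ_pos _, ?_⟩⟩
  have hcard : Fintype.card (Library N (F₀ + 1)) =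
      Fintype.card (Fin (2 ^ ⌊((F₀ + 1 : ℕ) : ℝ) * (N : ℝ)⌋₊)) := by
    rw [← Nat.cast_mul, Nat.floor_natCast]
    simp [pow_mul]
  let e := Fintype.equivOfCardEq hcard
  let S : Scheme N K (F₀ + 1) M fun _ => (N : ℝ) :=
    { cache := fun _ _ => ⟨0, by positivity⟩
      update := fun _ w => e w
      decode := fun k _ d x => e.symm x (d k) }
  refine ⟨S, ?_⟩
  have h0 (d : Requests N K) (k : Fin K) : S.userError d k = 0 := by
    simp [Scheme.userError, Scheme.estimate, S]
  simpa [Scheme.errorProb, h0] using hε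

/-- The minimum that defines the optimal average rate is attained, when every request vector has
positive probability: the rate tuples whose average is below a given one form a compact set. -/
lemma isLeast_optimalAvgRate {N K : ℕ} {p : Requests N K → ℝ} (hp : ∀ d, 0 < p d) {M : ℝ}
    (hM : 0 ≤ M) : IsLeast (avgRates p M) (optimalAvgRate p M) := by
  let avg (R : Requests N K → ℝ) : ℝ := ∑ d, p d * R d
  have havg : Continuous avg := by fun_prop
  let A : Set (Requests N K → ℝ) := {R | (M, R) ∈ optimalRegion N K}
  have hA : IsClosed A := isClosed_closure.preimage (Continuous.prodMk_right M)
  let R₀ : Requests N K → ℝ := fun _ => N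
  have hR₀ : R₀ ∈ A := subset_closure (achievable_const hM)
  have hcomp : IsCompact (A ∩ {R | avg R ≤ avg R₀}) := by
    refine (isCompact_Icc (a := (0 : Requests N K → ℝ))
      (b := fun d => avg R₀ / p d)).of_isClosed_subset
      (hA.inter (isClosed_le havg continuous_const)) ?_
    rintro R ⟨hR, hle⟩
    have hpos (d : Requests N K) : 0 ≤ R d := nonneg_of_mem_optimalRegion hR d
    refine ⟨hpos, fun d => (le_div_iff₀ (hp d)).2 (le_trans ?_ hle)⟩
    rw [mul_comm]
    exact single_le_sum (f := fun d => p d * R d)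
      (fun d _ => mul_nonneg (hp d).le (hpos d)) (mem_univ d)
  obtain ⟨R, hR, hmin⟩ := hcomp.exists_isMinOn ⟨R₀, hR₀, le_refl (avg R₀)⟩ havg.continuousOn
  have hleast : IsLeast (avgRates p M) (avg R) := by
    refine ⟨⟨R, hR.1, rfl⟩, ?_⟩
    rintro _ ⟨R', hR', rfl⟩
    by_cases h : avg R' ≤ avg R₀
    · exact hmin ⟨hR', h⟩
    · exact hR.2.trans (not_le.1 h).le
  rwa [optimalAvgRate, hleast.csInf_eq]

/-! ### Comparison with the decentralized scheme -/

lemma rateMN_nonneg {K N : ℕ} {M : ℝ} (hM : M ∈ Set.Icc (0 : ℝ) N) : 0 ≤ rateMN K N M := by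
  unfold rateMN
  split_ifs with h
  · positivity
  · have h0 : 0 < M := hM.1.lt_of_ne (Ne.symm h)
    have h1 : M / N ≤ 1 := div_le_one_of_le₀ hM.2 (Nat.cast_nonneg _)
    have h2 : 0 ≤ M / N := by positivity
    have h3 : (1 - M / N) ^ K ≤ 1 := pow_le_one₀ (by linarith) (by linarith)
    exact mul_nonneg (sub_nonneg.2 hM.2)
      (le_min (mul_nonneg (by positivity) (by linarith)) zero_le_one)

lemma convexifiedRateMN_le_rateMN {K N : ℕ} {M : ℝ} (hM : M ∈ Set.Icc (0 : ℝ) N) :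
    convexifiedRateMN K N M ≤ rateMN K N M := by
  refine csInf_le ⟨0, fun r hr => ?_⟩ (subset_convexHull ℝ _ ⟨M, hM, rfl⟩)
  have hconv : Convex ℝ {q : ℝ × ℝ | 0 ≤ q.2} :=
    convex_halfSpace_ge (LinearMap.snd ℝ ℝ ℝ).isLinear 0
  refine convexHull_min ?_ hconv hr
  rintro _ ⟨m, hm, rfl⟩
  exact rateMN_nonneg hm

/-- The rate of the decentralized scheme is at most `(N - M) * u` with `u ≤ min (K / N) 1` and
`u * M ≤ 1`. -/
lemma exists_rateMN_le {K N : ℕ} (hN : 0 < N) {M : ℝ} (hM : M ∈ Set.Icc (0 : ℝ) N) :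
    ∃ u : ℝ, u ≤ K / N ∧ u ≤ 1 ∧ u * M ≤ 1 ∧ rateMN K N M ≤ (N - M) * u := by
  have hN' : (0 : ℝ) < N := Nat.cast_pos.2 hN
  by_cases h : M = 0
  · refine ⟨min (K / N) 1, min_le_left _ _, min_le_right _ _, by simp [h], le_of_eq ?_⟩
    rw [rateMN, if_pos h, h, sub_zero, mul_min_of_nonneg _ _ hN'.le, mul_div_cancel₀ _ hN'.ne',
      mul_one]
  · have h0 : 0 < M := hM.1.lt_of_ne (Ne.symm h)
    have h1 : M / N ≤ 1 := div_le_one_of_le₀ hM.2 hN'.le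
    have hpow : 0 ≤ (1 - M / N) ^ K := pow_nonneg (by linarith) _
    have hbern : 1 + K * (-(M / N)) ≤ (1 + -(M / N)) ^ K :=
      one_add_mul_le_pow (by linarith) K
    rw [← sub_eq_add_neg] at hbern
    refine ⟨_, ?_, min_le_right _ _, ?_, by rw [rateMN, if_neg h]⟩
    · refine (min_le_left _ _).trans ?_
      rw [one_div, inv_mul_le_iff₀ h0]
      have : M * (K / N) = K * (M / N) := by ring
      linarith
    · refine (mul_le_mul_of_nonneg_right (min_le_left _ _) h0.le).trans ?_
      rw [mul_right_comm, one_div, inv_mul_cancel₀ h, one_mul]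
      linarith

/-- Optimizing the quadratic `converseRate N · M` over the number of users. With
`c = (1 + M) / (2 N)` and `b = 1 + (1 - M) / (2 N)` it reads `ℓ ↦ b ℓ - c ℓ ^ 2`, so that
`b - c = 1 - M / N` and `b + c = 1 + 1 / N`. -/
lemma exists_le_four_mul_converseRate {N K : ℕ} (hN : 0 < N) {M : ℝ}
    (hM : M ∈ Set.Icc (0 : ℝ) N) {u : ℝ} (huK : u ≤ K / N) (hu1 : u ≤ 1) (huM : u * M ≤ 1) :
    ∃ ℓ ≤ K, (N - M) * u ≤ 4 * converseRate N ℓ M := by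
  have hN' : (0 : ℝ) < N := Nat.cast_pos.2 hN
  obtain ⟨h0, h1⟩ := hM
  obtain ⟨c, hc⟩ : ∃ c, c = (1 + M) / (2 * N) := ⟨_, rfl⟩
  obtain ⟨b, hb⟩ : ∃ b, b = 1 + (1 - M) / (2 * N) := ⟨_, rfl⟩
  have hcpos : 0 < c := by rw [hc]; positivity
  have hsub : b - c = (N - M) / N := by rw [hb, hc]; field_simp; ring
  have hadd : b + c = (N + 1) / N := by rw [hb, hc]; field_simp; ring
  have hbc : c ≤ b := by
    rw [← sub_nonneg, hsub]
    exact div_nonneg (sub_nonneg.2 h1) hN'.le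
  have hrate (ℓ : ℕ) : converseRate N ℓ M = b * ℓ - c * ℓ ^ 2 := by
    rw [converseRate, hb, hc]
    field_simp
    ring
  rcases le_or_gt (2 * c * K) b with hK | hK
  · -- The quadratic is still increasing at `K`: all users are served.
    refine ⟨K, le_rfl, ?_⟩
    rw [hrate]
    have h2 : (N - M) * u ≤ (b - c) * K := by
      rw [hsub, div_mul_eq_mul_div, ← mul_div_assoc']
      exact mul_le_mul_of_nonneg_left huK (sub_nonneg.2 h1)
    have hK0 : (0 : ℝ) ≤ K := Nat.cast_nonneg K
    nlinarith [mul_le_mul_of_nonneg_right hK hK0, mul_nonneg hcpos.le hK0,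
      mul_nonneg (hcpos.le.trans hbc) hK0]
  · -- The integer nearest to the vertex `b / (2 c)` loses at most `c / 4` against the maximum.
    have hv : 0 ≤ b / (2 * c) := div_nonneg (hcpos.le.trans hbc) (by positivity)
    have hvK : b / (2 * c) < K := (div_lt_iff₀ (by positivity)).2 (by linarith)
    obtain ⟨v, hvdef⟩ : ∃ v, v = b / (2 * c) := ⟨_, rfl⟩
    rw [← hvdef] at hv hvK
    have hbv : b = 2 * c * v := by rw [hvdef]; field_simp
    have hfl := Nat.floor_le (show 0 ≤ v + 1 / 2 by positivity)
    have hlt := Nat.lt_floor_add_one (v + 1 / 2)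
    refine ⟨⌊v + 1 / 2⌋₊, ?_, ?_⟩
    · refine Nat.lt_succ_iff.1 ((Nat.floor_lt (by positivity)).2 ?_)
      push_cast
      linarith
    · rw [hrate]
      set m : ℝ := (⌊v + 1 / 2⌋₊ : ℝ)
      have hsq : (m - v) ^ 2 ≤ 1 / 4 := by nlinarith
      have h3 : c * (4 * (b * m - c * m ^ 2)) ≥ (b - c) * (b + c) := by
        have : c * (4 * (b * m - c * m ^ 2)) = b ^ 2 - 4 * c ^ 2 * (m - v) ^ 2 := by
          rw [hbv]; ring
        rw [this]
        nlinarith [mul_le_mul_of_nonneg_left hsq (sq_nonneg c)]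
      have h4 : c * ((N - M) * u) ≤ (b - c) * (b + c) := by
        have hcu : c * u * N ≤ 1 := by
          have : c * u * N = (u + u * M) / 2 := by rw [hc]; field_simp
          linarith
        have h5 : c * ((N - M) * u) = (b - c) * (c * u * N) := by rw [hsub]; field_simp
        have h6 : 1 ≤ b + c := by rw [hadd, one_le_div hN']; linarith
        rw [h5]
        exact mul_le_mul_of_nonneg_left (hcu.trans h6) (sub_nonneg.2 hbc)
      exact le_of_mul_le_mul_left (h4.trans h3) hcpos

end CodedCaching

open CodedCaching

theorem theorem4 (N K : ℕ) (hN : 1 ≤ N) (hK : 1 ≤ K) (M : ℝ) (hM : M ∈ Set.Ico (0 : ℝ) (N : ℝ)) :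
    IsLeast (CodedCaching.avgRates (CodedCaching.uniformRequests N K) M)
        (CodedCaching.optimalUniformRate N K M) ∧
      0 < CodedCaching.optimalUniformRate N K M ∧
      CodedCaching.convexifiedRateMN K N M / CodedCaching.optimalUniformRate N K M < 4.7 := by
  have hM' : M ∈ Set.Icc (0 : ℝ) N := Set.Ico_subset_Icc_self hM
  have hN' : (0 : ℝ) < N := Nat.cast_pos.2 hN
  have hleast : IsLeast (avgRates (uniformRequests N K) M) (optimalUniformRate N K M) :=
    isLeast_optimalAvgRate (uniformRequests_pos hN K) hM.1
  have hconv {ℓ : ℕ} (hℓ : ℓ ≤ K) : converseRate N ℓ M ≤ optimalUniformRate N K M := by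
    obtain ⟨R, hR, hRavg⟩ := hleast.1
    rw [← hRavg]
    exact converseRate_le_of_mem_optimalRegion hN hℓ hR
  have hpos : 0 < optimalUniformRate N K M := by
    refine lt_of_lt_of_le ?_ (hconv hK)
    have : converseRate N 1 M = 1 - M / N := by simp [converseRate]
    rw [this, sub_pos, div_lt_one hN']
    exact hM.2
  refine ⟨hleast, hpos, ?_⟩
  obtain ⟨u, huK, hu1, huM, hu⟩ := exists_rateMN_le (K := K) hN hM'
  obtain ⟨ℓ, hℓ, h4⟩ := exists_le_four_mul_converseRate hN hM' huK hu1 huM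
  rw [div_lt_iff₀ hpos]
  have := convexifiedRateMN_le_rateMN (K := K) hM'
  have := hconv hℓ
  linarith
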